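/- Let $n\ge 3$ and let $\sigma_x=\begin{pmatrix}0&1\\1&0\end{pmatrix}$, $\sigma_y=\begin{pmatrix}0&i\\-i&0\end{pmatrix}$, $\sigma_z=\begin{pmatrix}1&0\\0&-1\end{pmatrix}$, and let $\mathbf 1$ be the $2\times 2$ identity matrix. Write $\sigma^j$ for the $n$-fold tensor product with $\sigma$ in position $j$ and $\mathbf 1$ in every other position, and put $$H_0=\sum_{j=1}^{n-1}\sigma_z^j\sigma_z^{j+1}+\sigma_z^n\sigma_z^1,\qquad H_1=\sum_{j=1}^n\sigma_x^j .$$ Let $\mathcal L$ be the dynamical Lie algebra of the closed (periodic) spin chain, i.e. the real Lie algebra of $2^n\times 2^n$ complex matrices generated, under the commutator $[A,B]=AB-BA$, by $iH_0$ and $iH_1$. Let $C_n$ be the cyclic group generated by the translation $(1\,2\,\cdots\,n)$ of the tensor positions, acting on $(\mathbb C^2)^{\otimes n}$ by permutation matrices $P$, and let $\mathcal C(A)=\sum_{P\in C_n}PAP^{T}$. For $j=0,1,\dots,n-2$ define $$\mathbf Y^j=i\,\mathcal C(\sigma_y\otimes\sigma_x^{\otimes j}\otimes\sigma_y\otimes\mathbf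 1^{\otimes n-j-2}),\qquad \mathbf Z^j=i\,\mathcal C(\sigma_z\otimes\sigma_x^{\otimes j}\otimes\sigma_z\otimes\mathbf 1^{\otimes n-j-2}),$$ $$\mathbf{YZ}^j=i\,\mathcal C(\sigma_z\otimes\sigma_x^{\otimes j}\otimes\sigma_y\otimes\mathbf 1^{\otimes n-j-2})+i\,\mathcal C(\sigma_y\otimes\sigma_x^{\otimes j}\otimes\sigma_z\otimes\mathbf 1^{\otimes n-j-2}),$$ and $$\mathbf X=i\,\mathcal C(\sigma_x\otimes\mathbf 1^{\otimes n-1}),\qquad \mathbf{XX}=i\,\mathcal C(\sigma_x^{\otimes n-1}\otimes\mathbf 1).$$ Then the $3n-1$ matrices $\mathbf Y^j,\mathbf Z^j,\mathbf{YZ}^j$ ($j=0,1,\dots,n-2$), $\mathbf X$ and $\mathbf{XX}$ are skew-Hermitian, and together they form a basis of the real vector space $\mathcal L$. -/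

import Mathlib

-- The commutator bracket `⁅A, B⁆ = A * B - B * A` on an associative ring.
attribute [local instance 100] LieRing.ofAssociativeRing

namespace IsingChain

/-- Complex matrices on the state space `(ℂ²)^{⊗ n}` of `n` spins; the standard basis of this space
is indexed by the bit strings `Fin n → Fin 2`. -/
abbrev Op (n : ℕ) : Type := Matrix (Fin n → Fin 2) (Fin n → Fin 2) ℂ

/-- The Pauli matrix `σ_x`. -/
def sigmaX : Matrix (Fin 2) (Fin 2) ℂ := !![0, 1; 1, 0]

/-- The Pauli matrix `σ_y`, with the sign convention in which `[iσ_x, iσ_y] = 2iσ_z`. -/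
def sigmaY : Matrix (Fin 2) (Fin 2) ℂ := !![0, Complex.I; -Complex.I, 0]

/-- The Pauli matrix `σ_z`. -/
def sigmaZ : Matrix (Fin 2) (Fin 2) ℂ := !![1, 0; 0, -1]

/-- The tensor (Kronecker) product `s 0 ⊗ s 1 ⊗ ⋯ ⊗ s (n - 1)` of `n` matrices of size `2 × 2`. -/
def tensor {n : ℕ} (s : Fin n → Matrix (Fin 2) (Fin 2) ℂ) : Op n :=
  Matrix.of fun a b => ∏ k, s k (a k) (b k)

/-- `σ^j`: the tensor product with `σ` in position `j` and identities elsewhere. -/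
def site {n : ℕ} (σ : Matrix (Fin 2) (Fin 2) ℂ) (j : Fin n) : Op n :=
  tensor (Function.update (fun _ => 1) j σ)

/-- `H₀ = ∑_j σ_z^j σ_z^{j+1}`, where the successor of the last position is the first one
(`finRotate n j` is `j + 1` modulo `n`). -/
def H0 (n : ℕ) : Op n := ∑ j : Fin n, site sigmaZ j * site sigmaZ (finRotate n j)

/-- `H₁ = ∑_j σ_x^j`. -/
def H1 (n : ℕ) : Op n := ∑ j : Fin n, site sigmaX j

/-- The dynamical Lie algebra: the real Lie algebra generated by `i H₀` and `i H₁`, with the matrix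
commutator as bracket. -/
noncomputable def dynamicalLieAlgebra (n : ℕ) : LieSubalgebra ℝ (Op n) :=
  LieSubalgebra.lieSpan ℝ (Op n) {Complex.I • H0 n, Complex.I • H1 n}

/-- The permutation matrix by which a permutation `π` of the `n` positions acts on `(ℂ²)^{⊗ n}`:
the basis vector of the bit string `b` goes to that of the bit string `b ∘ π⁻¹`. -/
def permOp {n : ℕ} (π : Equiv.Perm (Fin n)) : Op n :=
  Matrix.of fun a b => if a = b ∘ π.symm then 1 else 0

/-- The cyclic group `C_n` generated by the translation `(1 2 ⋯ n)` of the positions. -/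
abbrev cyclicGroup (n : ℕ) : Subgroup (Equiv.Perm (Fin n)) := Subgroup.zpowers (finRotate n)

open Classical in
/-- The symmetrization `𝒞(A) = ∑_{P ∈ C_n} P A Pᵀ`. -/
noncomputable def symmetrize {n : ℕ} (A : Op n) : Op n :=
  ∑ π : cyclicGroup n, permOp (π : Equiv.Perm (Fin n)) * A * (permOp (π : Equiv.Perm (Fin n))).transpose

/-- `σ ⊗ σ_x^{⊗ j} ⊗ τ ⊗ 1^{⊗ (n - j - 2)}`. -/
def link (n j : ℕ) (σ τ : Matrix (Fin 2) (Fin 2) ℂ) : Op n :=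
  tensor fun k : Fin n =>
    if (k : ℕ) = 0 then σ
    else if (k : ℕ) ≤ j then sigmaX
    else if (k : ℕ) = j + 1 then τ
    else 1

/-- `𝐘^j = i 𝒞(σ_y ⊗ σ_x^{⊗ j} ⊗ σ_y ⊗ 1^{⊗ (n - j - 2)})`. -/
noncomputable def Y (n j : ℕ) : Op n := Complex.I • symmetrize (link n j sigmaY sigmaY)

/-- `𝐙^j = i 𝒞(σ_z ⊗ σ_x^{⊗ j} ⊗ σ_z ⊗ 1^{⊗ (n - j - 2)})`. -/
noncomputable def Z (n j : ℕ) : Op n := Complex.I • symmetrize (link n j sigmaZ sigmaZ)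

/-- `𝐘𝐙^j = i 𝒞(σ_z ⊗ σ_x^{⊗ j} ⊗ σ_y ⊗ 1^{⊗ (n - j - 2)})
  + i 𝒞(σ_y ⊗ σ_x^{⊗ j} ⊗ σ_z ⊗ 1^{⊗ (n - j - 2)})`. -/
noncomputable def YZ (n j : ℕ) : Op n :=
  Complex.I • symmetrize (link n j sigmaZ sigmaY) + Complex.I • symmetrize (link n j sigmaY sigmaZ)

/-- `𝐗 = i 𝒞(σ_x ⊗ 1^{⊗ (n - 1)})`. -/
noncomputable def X (n : ℕ) : Op n :=
  Complex.I • symmetrize (tensor fun k : Fin n => if (k : ℕ) = 0 then sigmaX else 1)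

/-- `𝐗𝐗 = i 𝒞(σ_x^{⊗ (n - 1)} ⊗ 1)`. -/
noncomputable def XX (n : ℕ) : Op n :=
  Complex.I • symmetrize (tensor fun k : Fin n => if (k : ℕ) + 1 < n then sigmaX else 1)

/-- Labels for the listed operators: `𝐘^j`, `𝐙^j`, `𝐘𝐙^j` with `0 ≤ j ≤ n - 2`, and `𝐗`, `𝐗𝐗`. -/
abbrev Label (n : ℕ) : Type := (Fin (n - 1) ⊕ Fin (n - 1) ⊕ Fin (n - 1)) ⊕ (Unit ⊕ Unit)

/-- The operator with a given label. -/
noncomputable def element (n : ℕ) : Label n → Op n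
  | .inl (.inl j) => Y n j
  | .inl (.inr (.inl j)) => Z n j
  | .inl (.inr (.inr j)) => YZ n j
  | .inr (.inl _) => X n
  | .inr (.inr _) => XX n

end IsingChain

/-!
The listed operators form three families of strings, which obey closed recursions under the brackets
with the two generators. Let
`x j` and `z j` be `σ_x` and `σ_z` at site `j`, with sites taken modulo `n`, and let `run x i m` be
the product of the `x`'s at the `m` consecutive sites from `i` on. Every operator of the list is, up
to a factor, a translation-invariant sum of words `z a * run x i m * z b` in which `a` and `b` lie
at or just outside the ends of the run, because `z x` and `x z` are multiples of `σ_y`; `𝐗𝐗` arises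
as a word that goes once around the chain and meets its own first letter (`XX_eq`). These sums are
`zStrings`, `yStrings` and `mixedStrings`. The bracket with `H₁` acts only on the two ends of such a
word. The bracket with `H₀` is a derivation under which the contributions from inside a run
telescope, which leaves the bonds at its two ends (`IsSpinChain.coupling_lie_run`). Hence both
generators change the lengths of words by at most one, without any case distinction for words that
wrap around the chain:
* `zStrings m` goes to multiples of `mixedStrings m` and `mixedStrings (m + 1)`,
* so does `yStrings m`,
* `mixedStrings (m + 1)` goes to multiples of `zStrings (m + 1) - yStrings m` and
  `yStrings (m + 1) - zStrings m`.

Since `H₀ = zStrings 0` and `H₁ = -yStrings 0`, climbing these recursions puts all words into the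
generated Lie algebra (`strings_mem_dynamicalLieAlgebra`). Conversely, the span of the list is
stable under both generators, as `mixedStrings 0 = mixedStrings n = 0`, and it therefore contains the
Lie algebra they generate (`lieSpan_le_of_lie_mem`, `span_element_eq`).

For linear independence, distinct tensor products of Pauli matrices are orthogonal for the trace
form. Translation preserves how often each letter occurs in a word, and for `n ≥ 3` these numbers
tell the listed operators apart (`labelWeight_injective`). Pairing with one word of a given operator
thus kills all the other operators, and it does not kill that operator, as the multiplicities with
which words occur are not negative (`trace_wordOp_mul_element`).
-/

namespace IsingChain

/-! ### Brackets of strings in an abstract spin chain -/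

/-- Two families with the relations of `σ_x` and `σ_z` at the sites `i : ι` of a chain. In what
follows the sites form a commutative ring, so that `i + 1` is the next site and natural numbers can
be added to sites; for a periodic chain this is the ring of integers modulo its length. -/
structure IsSpinChain {ι R : Type*} [Ring R] (x z : ι → R) : Prop where
  x_sq : ∀ i, x i * x i = 1
  z_sq : ∀ i, z i * z i = 1
  x_comm : ∀ i j, x i * x j = x j * x i
  z_comm : ∀ i j, z i * z j = z j * z i
  anticomm : ∀ i, x i * z i = -(z i * x i)
  comm : ∀ i j, i ≠ j → x i * z j = z j * x i

section Strings

variable {ι R : Type*} [Ring R] {x z : ι → R}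

theorem lie_mul_mul (h a t b : R) :
    ⁅h, a * t * b⁆ = ⁅h, a⁆ * t * b + a * ⁅h, t⁆ * b + a * t * ⁅h, b⁆ := by
  simp only [Ring.lie_def]; noncomm_ring

theorem IsSpinChain.z_mul_cancel_left (h : IsSpinChain x z) (i : ι) (a : R) :
    z i * (z i * a) = a := by
  rw [← mul_assoc, h.z_sq, one_mul]

section Field

variable [Fintype ι]

theorem IsSpinChain.field_lie_x (h : IsSpinChain x z) (j : ι) : ⁅∑ i, x i, x j⁆ = 0 := by
  rw [sum_lie]
  refine Finset.sum_eq_zero fun i _ => ?_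
  rw [Ring.lie_def, h.x_comm i j, sub_self]

theorem IsSpinChain.field_lie_z (h : IsSpinChain x z) (j : ι) :
    ⁅∑ i, x i, z j⁆ = 2 • (x j * z j) := by
  rw [sum_lie, Finset.sum_eq_single j]
  · rw [Ring.lie_def, h.anticomm j]; abel
  · intro i _ hi
    rw [Ring.lie_def, h.comm i j hi, sub_self]
  · simp

end Field

variable [CommRing ι]

/-- The ordered product `x i * x (i + 1) * ⋯ * x (i + m - 1)`. -/
def run (x : ι → R) (i : ι) : ℕ → R
  | 0 => 1
  | m + 1 => run x i m * x (i + m)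

/-- The string `z a * (x i * ⋯ * x (i + m - 1)) * z b`. -/
def str (x z : ι → R) (a i : ι) (m : ℕ) (b : ι) : R := z a * run x i m * z b

theorem run_succ' (x : ι → R) (i : ι) (m : ℕ) : run x i (m + 1) = x i * run x (i + 1) m := by
  induction m with
  | zero => simp [run]
  | succ m ih =>
    rw [run, ih, run, mul_assoc]
    congr 3
    push_cast; ring

theorem IsSpinChain.x_mul_run (h : IsSpinChain x z) (i : ι) (m : ℕ) :
    x i * run x i (m + 1) = run x (i + 1) m := by
  rw [run_succ', ← mul_assoc, h.x_sq, one_mul]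

theorem IsSpinChain.run_mul_x (h : IsSpinChain x z) (i : ι) (m : ℕ) :
    run x i (m + 1) * x (i + m) = run x i m := by
  rw [run, mul_assoc, h.x_sq, mul_one]

theorem IsSpinChain.x_mul_run_comm (h : IsSpinChain x z) (j i : ι) (m : ℕ) :
    x j * run x i m = run x i m * x j := by
  induction m with
  | zero => simp [run]
  | succ m ih => rw [run, ← mul_assoc, ih, mul_assoc, h.x_comm j, mul_assoc]

variable [Fintype ι]

/-- The Ising coupling `∑ i, z i * z (i + 1)`. -/
def coupling (z : ι → R) : R := ∑ i, z i * z (i + 1)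

theorem IsSpinChain.coupling_lie_z (h : IsSpinChain x z) (j : ι) : ⁅coupling z, z j⁆ = 0 := by
  rw [coupling, sum_lie]
  refine Finset.sum_eq_zero fun i _ => ?_
  rw [Ring.lie_def, mul_assoc, h.z_comm (i + 1) j, ← mul_assoc, h.z_comm i j, mul_assoc, sub_self]

theorem IsSpinChain.coupling_lie_x [Nontrivial ι] (h : IsSpinChain x z) (j : ι) :
    ⁅coupling z, x j⁆ = 2 • (z (j - 1) * z j * x j) - 2 • (x j * (z j * z (j + 1))) := by
  classical
  have key : ∀ i, ⁅z i * z (i + 1), x j⁆ =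
      (if i = j - 1 then 2 • (z (j - 1) * z j * x j) else 0) +
        if i = j then - (2 • (x j * (z j * z (j + 1)))) else 0 := by
    intro i
    rw [Ring.lie_def]
    by_cases h1 : i = j - 1
    · subst h1
      have h2 : j ≠ j - 1 := fun e => one_ne_zero (sub_eq_self.mp e.symm)
      rw [if_pos rfl, if_neg h2.symm, sub_add_cancel, ← mul_assoc (x j), h.comm _ _ h2,
        mul_assoc _ (x j), h.anticomm]
      noncomm_ring
    · by_cases h2 : i = j
      · subst h2
        have h3 : i ≠ i + 1 := by simp
        rw [if_neg h1, if_pos rfl, mul_assoc, ← h.comm _ _ h3, ← mul_assoc (x i),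
          ← mul_assoc (z i), h.anticomm]
        noncomm_ring
      · have h3 : j ≠ i + 1 := fun e => h1 (by rw [e]; ring)
        rw [if_neg h1, if_neg h2, mul_assoc, ← h.comm _ _ h3, ← mul_assoc, ← mul_assoc,
          ← h.comm _ _ (Ne.symm h2)]
        noncomm_ring
  rw [coupling, sum_lie, Finset.sum_congr rfl fun i _ => key i, Finset.sum_add_distrib]
  simp [sub_eq_add_neg]

/-- Inside a run the contributions of neighbouring factors telescope, so that only the bonds at its
two ends survive. -/
theorem IsSpinChain.coupling_lie_run [Nontrivial ι] (h : IsSpinChain x z) (j : ι) (m : ℕ) :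
    ⁅coupling z, run x j m⁆ =
      2 • (z (j - 1) * z j * run x j m) - 2 • (run x j m * (z (j + m - 1) * z (j + m))) := by
  induction m with
  | zero => simp [run, Ring.lie_def]
  | succ m ih =>
    have hd : ∀ a b : R, ⁅coupling z, a * b⁆ = ⁅coupling z, a⁆ * b + a * ⁅coupling z, b⁆ := by
      intro a b; simp only [Ring.lie_def]; noncomm_ring
    rw [run, hd, ih, h.coupling_lie_x]
    have e1 : j + ((m + 1 : ℕ) : ι) - 1 = j + m := by push_cast; ring
    have e2 : j + ((m + 1 : ℕ) : ι) = j + m + 1 := by push_cast; ring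
    rw [e1, e2]
    noncomm_ring

theorem IsSpinChain.field_lie_run (h : IsSpinChain x z) (j : ι) (m : ℕ) :
    ⁅∑ i, x i, run x j m⁆ = 0 := by
  induction m with
  | zero => simp [run, Ring.lie_def]
  | succ m ih =>
    have hd : ∀ a b : R, ⁅∑ i, x i, a * b⁆ = ⁅∑ i, x i, a⁆ * b + a * ⁅∑ i, x i, b⁆ := by
      intro a b; simp only [Ring.lie_def]; noncomm_ring
    rw [run, hd, ih, h.field_lie_x]; simp

theorem IsSpinChain.coupling_lie_str [Nontrivial ι] (h : IsSpinChain x z) (a i b : ι) (m : ℕ) :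
    ⁅coupling z, str x z a i m b⁆ =
      2 • (z a * (z (i - 1) * z i * run x i m) * z b)
        - 2 • (z a * (run x i m * (z (i + m - 1) * z (i + m))) * z b) := by
  rw [str, lie_mul_mul, h.coupling_lie_z, h.coupling_lie_z, h.coupling_lie_run]
  noncomm_ring

theorem IsSpinChain.field_lie_str (h : IsSpinChain x z) (a i b : ι) (m : ℕ) :
    ⁅∑ i, x i, str x z a i m b⁆ =
      2 • (z a * (run x i m * x b) * z b) - 2 • (z a * (x a * run x i m) * z b) := by
  rw [str, lie_mul_mul, h.field_lie_z, h.field_lie_z, h.field_lie_run, h.anticomm a]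
  noncomm_ring

/-- The translation-invariant sum of the strings `z ⊗ x^{⊗ m} ⊗ z`. -/
def zStrings (x z : ι → R) (m : ℕ) : R := ∑ j, str x z j (j + 1) m (j + m + 1)

/-- The translation-invariant sum of the strings `zx ⊗ x^{⊗ (m - 1)} ⊗ xz`, that is,
`y ⊗ x^{⊗ (m - 1)} ⊗ y`; for `m = 0` it is the sum of the `zxz = -x`. -/
def yStrings (x z : ι → R) (m : ℕ) : R := ∑ j, str x z j j (m + 1) (j + m)

/-- The translation-invariant sum of the differences
`zx ⊗ x^{⊗ (m - 1)} ⊗ z - z ⊗ x^{⊗ (m - 1)} ⊗ xz`, where `zx` and `xz` are multiples of `y`. For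
`m = 0` both strings are `zz = 1`. -/
def mixedStrings (x z : ι → R) (m : ℕ) : R :=
  ∑ j, (str x z j j m (j + m) - str x z j (j + 1) m (j + m))

theorem sum_add_one (f : ι → R) : ∑ j, f (j + 1) = ∑ j, f j :=
  Equiv.sum_comp (Equiv.addRight (1 : ι)) f

theorem sum_sub_one (f : ι → R) : ∑ j, f (j - 1) = ∑ j, f j :=
  Equiv.sum_comp (Equiv.subRight (1 : ι)) f

section Coupling

variable [Nontrivial ι]

theorem IsSpinChain.coupling_lie_zStrings (h : IsSpinChain x z) (m : ℕ) :
    ⁅coupling z, zStrings x z m⁆ = 2 • mixedStrings x z m := by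
  have key : ∀ j, ⁅coupling z, str x z j (j + 1) m (j + m + 1)⁆ =
      2 • str x z (j + 1) (j + 1) m (j + 1 + m) - 2 • str x z j (j + 1) m (j + m) := by
    intro j
    rw [h.coupling_lie_str]
    have e2 : j + 1 + (m : ι) = j + m + 1 := by ring
    simp only [str, add_sub_cancel_right, e2]
    congr 2
    · simp only [mul_assoc, h.z_mul_cancel_left]
    · simp only [mul_assoc, h.z_sq, mul_one]
  simp only [zStrings, lie_sum, key, Finset.sum_sub_distrib, mixedStrings, ← Finset.smul_sum,
    smul_sub]
  rw [sum_add_one fun j => str x z j j m (j + m)]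

theorem IsSpinChain.coupling_lie_yStrings (h : IsSpinChain x z) (m : ℕ) :
    ⁅coupling z, yStrings x z m⁆ = -(2 • mixedStrings x z (m + 1)) := by
  have key : ∀ j, ⁅coupling z, str x z j j (m + 1) (j + m)⁆ =
      2 • str x z (j - 1) (j - 1 + 1) (m + 1) (j - 1 + (m + 1 : ℕ))
        - 2 • str x z j j (m + 1) (j + (m + 1 : ℕ)) := by
    intro j
    rw [h.coupling_lie_str]
    have e1 : j + ((m + 1 : ℕ) : ι) - 1 = j + m := by push_cast; ring
    have e2 : j - 1 + ((m + 1 : ℕ) : ι) = j + m := by push_cast; ring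
    simp only [str, sub_add_cancel, e1, e2]
    congr 2
    · rw [h.z_comm (j - 1) j]
      simp only [mul_assoc, h.z_mul_cancel_left]
    · rw [h.z_comm (j + m)]
      simp only [mul_assoc, h.z_sq, mul_one]
  simp only [yStrings, lie_sum, key, Finset.sum_sub_distrib, mixedStrings, ← Finset.smul_sum,
    smul_sub]
  rw [sum_sub_one fun j => str x z j (j + 1) (m + 1) (j + (m + 1 : ℕ))]
  abel

theorem IsSpinChain.coupling_lie_mixedStrings (h : IsSpinChain x z) (m : ℕ) :
    ⁅coupling z, mixedStrings x z (m + 1)⁆ = 4 • (zStrings x z (m + 1) - yStrings x z m) := by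
  have key1 : ∀ j, ⁅coupling z, str x z j j (m + 1) (j + (m + 1 : ℕ))⁆ =
      2 • str x z (j - 1) (j - 1 + 1) (m + 1) (j - 1 + (m + 1 : ℕ) + 1)
        - 2 • str x z j j (m + 1) (j + m) := by
    intro j
    rw [h.coupling_lie_str]
    have e1 : j + ((m + 1 : ℕ) : ι) - 1 = j + m := by push_cast; ring
    have e2 : j - 1 + ((m + 1 : ℕ) : ι) + 1 = j + (m + 1 : ℕ) := by ring
    simp only [str, sub_add_cancel, e1, e2]
    congr 2
    · rw [h.z_comm (j - 1) j]
      simp only [mul_assoc, h.z_mul_cancel_left]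
    · simp only [mul_assoc, h.z_sq, mul_one]
  have key2 : ∀ j, ⁅coupling z, str x z j (j + 1) (m + 1) (j + (m + 1 : ℕ))⁆ =
      2 • str x z (j + 1) (j + 1) (m + 1) (j + 1 + m)
        - 2 • str x z j (j + 1) (m + 1) (j + (m + 1 : ℕ) + 1) := by
    intro j
    rw [h.coupling_lie_str]
    have e2 : j + 1 + (m : ι) = j + (m + 1 : ℕ) := by push_cast; ring
    have e3 : j + 1 + ((m + 1 : ℕ) : ι) = j + (m + 1 : ℕ) + 1 := by ring
    simp only [str, add_sub_cancel_right, e2, e3]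
    congr 2
    · simp only [mul_assoc, h.z_mul_cancel_left]
    · rw [h.z_comm (j + (m + 1 : ℕ))]
      simp only [mul_assoc, h.z_sq, mul_one]
  simp only [mixedStrings, lie_sum, lie_sub, key1, key2, Finset.sum_sub_distrib, ← Finset.smul_sum]
  rw [sum_sub_one fun j => str x z j (j + 1) (m + 1) (j + (m + 1 : ℕ) + 1),
    sum_add_one fun j => str x z j j (m + 1) (j + m), ← zStrings, ← yStrings]
  module

end Coupling

theorem IsSpinChain.field_lie_zStrings (h : IsSpinChain x z) (m : ℕ) :
    ⁅∑ i, x i, zStrings x z m⁆ = -(2 • mixedStrings x z (m + 1)) := by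
  rw [zStrings, lie_sum, mixedStrings, Finset.smul_sum, ← Finset.sum_neg_distrib]
  refine Finset.sum_congr rfl fun j _ => ?_
  have e1 : j + ((m + 1 : ℕ) : ι) = j + 1 + m := by push_cast; ring
  have e2 : j + (m : ι) + 1 = j + 1 + m := by ring
  rw [h.field_lie_str, ← run_succ', e1, e2, ← run, str, str]
  noncomm_ring

theorem IsSpinChain.field_lie_yStrings (h : IsSpinChain x z) (m : ℕ) :
    ⁅∑ i, x i, yStrings x z m⁆ = 2 • mixedStrings x z m := by
  rw [yStrings, lie_sum, mixedStrings, Finset.smul_sum]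
  refine Finset.sum_congr rfl fun j _ => ?_
  rw [h.field_lie_str, h.x_mul_run, h.run_mul_x, str, str]
  noncomm_ring

theorem IsSpinChain.field_lie_mixedStrings (h : IsSpinChain x z) (m : ℕ) :
    ⁅∑ i, x i, mixedStrings x z (m + 1)⁆ = 4 • (yStrings x z (m + 1) - zStrings x z m) := by
  rw [yStrings, zStrings, mixedStrings, lie_sum, ← Finset.sum_sub_distrib, Finset.smul_sum]
  refine Finset.sum_congr rfl fun j _ => ?_
  have e1 : j + ((m + 1 : ℕ) : ι) = j + 1 + m := by push_cast; ring
  have e2 : j + (m : ι) + 1 = j + 1 + m := by ring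
  rw [lie_sub, h.field_lie_str, h.field_lie_str, ← run_succ', h.x_mul_run, ← run, e1, h.run_mul_x,
    ← e1, str, str, e2, ← e1]
  noncomm_ring

theorem zStrings_zero (x z : ι → R) : zStrings x z 0 = coupling z := by
  simp [zStrings, coupling, str, run]

theorem IsSpinChain.yStrings_zero (h : IsSpinChain x z) : yStrings x z 0 = -∑ i, x i := by
  rw [yStrings, ← Finset.sum_neg_distrib]
  refine Finset.sum_congr rfl fun j _ => ?_
  simp only [str, run, Nat.cast_zero, add_zero, one_mul, mul_assoc, h.anticomm, mul_neg,
    h.z_mul_cancel_left]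

theorem IsSpinChain.mixedStrings_zero (h : IsSpinChain x z) : mixedStrings x z 0 = 0 := by
  simp [mixedStrings, str, run, h.z_sq]

/-- If going `n` steps leads back to the start, the two strings that wrap around the whole chain
coincide. -/
theorem IsSpinChain.mixedStrings_of_cast_eq_zero (h : IsSpinChain x z) {n : ℕ}
    (hn : (n : ι) = 0) : mixedStrings x z n = 0 := by
  refine Finset.sum_eq_zero fun j _ => ?_
  have e : run x j n = run x (j + 1) n := by
    obtain _ | k := n
    · rfl
    · have e1 : j + 1 + (k : ι) = j := by
        push_cast at hn
        rw [add_assoc, add_comm 1, hn, add_zero]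
      rw [run_succ', run, e1, h.x_mul_run_comm]
  rw [str, str, e, sub_self]

end Strings

/-! ### Tensor products of `2 × 2` matrices -/

section Tensor

variable {n : ℕ}

theorem tensor_mul (s t : Fin n → Matrix (Fin 2) (Fin 2) ℂ) :
    tensor s * tensor t = tensor fun k => s k * t k := by
  ext a b
  simp only [tensor, Matrix.mul_apply, Matrix.of_apply, ← Finset.prod_mul_distrib]
  rw [Finset.prod_univ_sum, Fintype.piFinset_univ]

theorem tensor_one : tensor (fun _ : Fin n => (1 : Matrix (Fin 2) (Fin 2) ℂ)) = 1 := by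
  ext a b
  simp only [tensor, Matrix.of_apply, Matrix.one_apply, Finset.prod_ite_zero, Finset.prod_const_one,
    Finset.mem_univ, true_imp_iff, funext_iff]

theorem trace_tensor (s : Fin n → Matrix (Fin 2) (Fin 2) ℂ) :
    (tensor s).trace = ∏ k, (s k).trace := by
  simp only [Matrix.trace, Matrix.diag, tensor, Matrix.of_apply]
  rw [Finset.prod_univ_sum, Fintype.piFinset_univ]

theorem conjTranspose_tensor (s : Fin n → Matrix (Fin 2) (Fin 2) ℂ) :
    (tensor s).conjTranspose = tensor fun k => (s k).conjTranspose := by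
  ext a b
  simp [tensor, Matrix.conjTranspose_apply]

theorem site_mul_tensor (σ : Matrix (Fin 2) (Fin 2) ℂ) (i : Fin n)
    (s : Fin n → Matrix (Fin 2) (Fin 2) ℂ) :
    site σ i * tensor s = tensor fun k => if k = i then σ * s k else s k := by
  rw [site, tensor_mul]
  congr 1; ext1 k
  by_cases h : k = i
  · subst h; simp
  · simp [h]

theorem tensor_mul_site (σ : Matrix (Fin 2) (Fin 2) ℂ) (i : Fin n)
    (s : Fin n → Matrix (Fin 2) (Fin 2) ℂ) :
    tensor s * site σ i = tensor fun k => if k = i then s k * σ else s k := by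
  rw [site, tensor_mul]
  congr 1; ext1 k
  by_cases h : k = i
  · subst h; simp
  · simp [h]

theorem site_mul_site_self (σ τ : Matrix (Fin 2) (Fin 2) ℂ) (i : Fin n) :
    site σ i * site τ i = site (σ * τ) i := by
  rw [site, site, tensor_mul]
  congr 1; ext1 k
  by_cases h : k = i
  · subst h; simp
  · simp [h]

theorem site_comm (σ τ : Matrix (Fin 2) (Fin 2) ℂ) {i j : Fin n} (h : i ≠ j) :
    site σ i * site τ j = site τ j * site σ i := by
  rw [site, site, tensor_mul, tensor_mul]
  congr 1; ext1 k
  by_cases h1 : k = i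
  · subst h1; simp [h]
  · simp [h1]

theorem site_one (i : Fin n) : site 1 i = 1 := by
  rw [site, ← tensor_one]
  congr 1
  exact Function.update_eq_self i _

theorem site_smul (c : ℂ) (σ : Matrix (Fin 2) (Fin 2) ℂ) (i : Fin n) :
    site (c • σ) i = c • site σ i := by
  ext a b
  have hp : ∀ k, Function.update (fun _ => (1 : Matrix (Fin 2) (Fin 2) ℂ)) i (c • σ) k (a k) (b k) =
      (if k = i then c else 1) *
        Function.update (fun _ => (1 : Matrix (Fin 2) (Fin 2) ℂ)) i σ k (a k) (b k) := by
    intro k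
    by_cases h : k = i
    · subst h; simp
    · simp [h]
  simp only [site, tensor, Matrix.of_apply, Matrix.smul_apply, smul_eq_mul, hp]
  rw [Finset.prod_mul_distrib, Finset.prod_ite_eq' Finset.univ i, if_pos (Finset.mem_univ i)]

end Tensor

theorem sigmaX_mul_sigmaX : sigmaX * sigmaX = 1 := by
  simp [sigmaX, Matrix.one_fin_two]

theorem sigmaZ_mul_sigmaZ : sigmaZ * sigmaZ = 1 := by
  simp [sigmaZ, Matrix.one_fin_two]

theorem sigmaX_mul_sigmaZ : sigmaX * sigmaZ = Complex.I • sigmaY := by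
  simp [sigmaX, sigmaY, sigmaZ]

theorem sigmaZ_mul_sigmaX : sigmaZ * sigmaX = -Complex.I • sigmaY := by
  simp [sigmaX, sigmaY, sigmaZ]

section Chain

open Fin.CommRing

variable {n : ℕ}

theorem isSpinChain_site : IsSpinChain (ι := Fin n) (site sigmaX) (site sigmaZ) where
  x_sq i := by rw [site_mul_site_self, sigmaX_mul_sigmaX, site_one]
  z_sq i := by rw [site_mul_site_self, sigmaZ_mul_sigmaZ, site_one]
  x_comm i j := by
    by_cases h : i = j
    · rw [h]
    · exact site_comm _ _ h
  z_comm i j := by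
    by_cases h : i = j
    · rw [h]
    · exact site_comm _ _ h
  anticomm i := by
    rw [site_mul_site_self, site_mul_site_self, sigmaX_mul_sigmaZ, sigmaZ_mul_sigmaX, site_smul,
      site_smul, neg_smul, neg_neg]
  comm _ _ h := site_comm _ _ h

theorem permOp_mul_tensor_mul_transpose (π : Equiv.Perm (Fin n))
    (s : Fin n → Matrix (Fin 2) (Fin 2) ℂ) :
    permOp π * tensor s * (permOp π).transpose = tensor fun k => s (π.symm k) := by
  have hp : ∀ a b : Fin n → Fin 2, (a = b ∘ π.symm) ↔ (b = a ∘ π) := by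
    intro a b
    constructor
    · rintro rfl; ext; simp
    · rintro rfl; ext; simp
  ext a b
  simp only [Matrix.mul_apply, permOp, Matrix.transpose_apply, Matrix.of_apply, hp, ite_mul, mul_ite,
    one_mul, zero_mul, mul_one, mul_zero, Finset.sum_ite_eq', Finset.mem_univ, if_true, tensor,
    Function.comp_apply]
  exact Fintype.prod_equiv π _ _ fun k => by simp

theorem site_sigmaY_mul_sigmaX (j : Fin n) :
    site (sigmaY * sigmaX) j = Complex.I • site sigmaZ j := by
  rw [← site_smul]
  congr 1
  simp [sigmaX, sigmaY, sigmaZ]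

variable [NeZero n]

theorem H0_eq_coupling : H0 n = coupling (ι := Fin n) (site sigmaZ) := by
  simp only [H0, coupling, finRotate_apply]

theorem finRotate_zpow (i : ℤ) (k : Fin n) : (finRotate n ^ i) k = k + (i : Fin n) := by
  induction i using Int.induction_on generalizing k with
  | zero => simp
  | succ i ih =>
    rw [zpow_add_one, Equiv.Perm.mul_apply, finRotate_apply, ih]; push_cast; ring
  | pred i ih =>
    have e : (finRotate n)⁻¹ k = k - 1 := by
      rw [Equiv.Perm.inv_eq_iff_eq, finRotate_apply, sub_add_cancel]
    rw [zpow_sub_one, Equiv.Perm.mul_apply, e, ih]; push_cast; ring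

theorem addRight_mem_cyclicGroup (j : Fin n) : Equiv.addRight j ∈ cyclicGroup n := by
  refine ⟨(j.val : ℤ), Equiv.ext fun k => ?_⟩
  change (finRotate n ^ (j.val : ℤ)) k = k + j
  rw [finRotate_zpow, Int.cast_natCast, Fin.cast_val_eq_self]

/-- The cyclic group consists of the translations `k ↦ k + j`. -/
theorem symmetrize_tensor (s : Fin n → Matrix (Fin 2) (Fin 2) ℂ) :
    symmetrize (tensor s) = ∑ j : Fin n, tensor fun k => s (k - j) := by
  classical
  rw [symmetrize]
  symm
  refine Finset.sum_bij (fun j _ => ⟨Equiv.addRight j, addRight_mem_cyclicGroup j⟩)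
    (fun _ _ => Finset.mem_univ _) ?_ ?_ ?_
  · intro i _ j _ h
    have := congrArg (fun π : cyclicGroup n => (π : Equiv.Perm (Fin n)) 0) h
    simpa using this
  · rintro ⟨π, i, rfl⟩ _
    refine ⟨(i : Fin n), Finset.mem_univ _, Subtype.ext (Equiv.ext fun k => ?_)⟩
    simp [finRotate_zpow]
  · intro j _
    rw [permOp_mul_tensor_mul_transpose]
    simp [sub_eq_add_neg]

theorem run_site (j : Fin n) {m : ℕ} (hm : m ≤ n) :
    run (site sigmaX) j m = tensor fun k : Fin n => if (k - j).val < m then sigmaX else 1 := by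
  induction m with
  | zero => simp [run, tensor_one]
  | succ m ih =>
    rw [run, ih (by omega), tensor_mul_site]
    congr 1; ext1 k
    have hk : k = j + m ↔ (k - j).val = m := by
      rw [← sub_eq_iff_eq_add', Fin.ext_iff, Fin.val_natCast, Nat.mod_eq_of_lt (by omega)]
    simp only [hk]
    split_ifs <;> first | omega | simp

theorem link_translate (j : Fin n) {m : ℕ} (hm : m + 1 < n) (σ τ : Matrix (Fin 2) (Fin 2) ℂ) :
    (tensor fun k : Fin n =>
      if ((k - j : Fin n) : ℕ) = 0 then σ
      else if ((k - j : Fin n) : ℕ) ≤ m then sigmaX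
      else if ((k - j : Fin n) : ℕ) = m + 1 then τ
      else 1) =
    site (σ * sigmaX) j * run (site sigmaX) j (m + 1) * site τ (j + ((m + 1 : ℕ) : Fin n)) := by
  rw [run_site _ hm.le, site_mul_tensor, tensor_mul_site]
  congr 1; ext1 k
  have hk : k = j + ((m + 1 : ℕ) : Fin n) ↔ (k - j).val = m + 1 := by
    rw [← sub_eq_iff_eq_add', Fin.ext_iff, Fin.val_natCast, Nat.mod_eq_of_lt hm]
  have h0 : k = j ↔ (k - j).val = 0 := by
    rw [← sub_eq_zero, Fin.ext_iff, Fin.val_zero]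
  simp only [hk, h0]
  split_ifs <;> first | omega | simp [mul_assoc, sigmaX_mul_sigmaX]

theorem symmetrize_link {m : ℕ} (hm : m + 1 < n) (σ τ : Matrix (Fin 2) (Fin 2) ℂ) :
    symmetrize (link n m σ τ) = ∑ j : Fin n,
      site (σ * sigmaX) j * run (site sigmaX) j (m + 1) * site τ (j + ((m + 1 : ℕ) : Fin n)) := by
  rw [link, symmetrize_tensor]
  exact Finset.sum_congr rfl fun j _ => link_translate j hm σ τ

/-- Multiplication by `σ_x` at the first position shortens a run that starts there. -/
theorem site_sigmaZ_mul_sigmaX_mul_run (j : Fin n) (m : ℕ) :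
    site (sigmaZ * sigmaX) j * run (site sigmaX) j (m + 1) =
      site sigmaZ j * run (site sigmaX) (j + 1) m := by
  rw [← site_mul_site_self, mul_assoc, isSpinChain_site.x_mul_run]

theorem run_mul_site_sigmaY (j : Fin n) (m : ℕ) :
    run (site sigmaX) j m * site sigmaY (j + (m : Fin n)) =
      -Complex.I • (run (site sigmaX) j (m + 1) * site sigmaZ (j + (m : Fin n))) := by
  have e : sigmaY = -Complex.I • (sigmaX * sigmaZ) := by
    rw [sigmaX_mul_sigmaZ, smul_smul]; simp
  rw [e, site_smul, ← site_mul_site_self, mul_smul_comm, run, mul_assoc]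

theorem Z_eq {m : ℕ} (hm : m + 1 < n) :
    Z n m = Complex.I • zStrings (ι := Fin n) (site sigmaX) (site sigmaZ) m := by
  rw [Z, symmetrize_link hm, zStrings]
  refine congrArg (Complex.I • ·) (Finset.sum_congr rfl fun j _ => ?_)
  rw [site_sigmaZ_mul_sigmaX_mul_run, str, Nat.cast_succ, add_assoc]

theorem Y_eq {m : ℕ} (hm : m + 1 < n) :
    Y n m = Complex.I • yStrings (ι := Fin n) (site sigmaX) (site sigmaZ) (m + 1) := by
  rw [Y, symmetrize_link hm, yStrings]
  refine congrArg (Complex.I • ·) (Finset.sum_congr rfl fun j _ => ?_)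
  rw [site_sigmaY_mul_sigmaX, mul_assoc, run_mul_site_sigmaY, smul_mul_smul_comm, str, mul_assoc]
  simp

theorem YZ_eq {m : ℕ} (hm : m + 1 < n) :
    YZ n m = -mixedStrings (ι := Fin n) (site sigmaX) (site sigmaZ) (m + 1) := by
  rw [YZ, symmetrize_link hm, symmetrize_link hm, mixedStrings, Finset.smul_sum, Finset.smul_sum,
    ← Finset.sum_add_distrib, ← Finset.sum_neg_distrib]
  refine Finset.sum_congr rfl fun j _ => ?_
  rw [site_sigmaY_mul_sigmaX, mul_assoc, run_mul_site_sigmaY, mul_smul_comm, ← mul_assoc,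
    site_sigmaZ_mul_sigmaX_mul_run, smul_mul_assoc, smul_mul_assoc, smul_smul, smul_smul, ← str,
    ← str]
  simp [sub_eq_add_neg]

theorem tensor_single_translate (j : Fin n) :
    (tensor fun k : Fin n => if ((k - j : Fin n) : ℕ) = 0 then sigmaX else 1) = site sigmaX j := by
  rw [site]
  congr 1; ext1 k
  have h0 : k = j ↔ (k - j).val = 0 := by
    rw [← sub_eq_zero, Fin.ext_iff, Fin.val_zero]
  rw [Function.update_apply]
  simp only [h0]

theorem X_eq_H1 : X n = Complex.I • H1 n := by
  rw [X, symmetrize_tensor, H1]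
  congr 1
  exact Finset.sum_congr rfl fun j _ => tensor_single_translate j

theorem X_eq : X n = -(Complex.I • yStrings (ι := Fin n) (site sigmaX) (site sigmaZ) 0) := by
  rw [X_eq_H1, isSpinChain_site.yStrings_zero, smul_neg, neg_neg, H1]

/-- The string that starts and ends at the same site after one turn around the chain loses its two
end letters `σ_z`, which commute with the run of length `n - 1` between them. -/
theorem XX_eq {m : ℕ} (hm : m + 1 = n) :
    XX n = Complex.I • zStrings (ι := Fin n) (site sigmaX) (site sigmaZ) m := by
  have hcast : (m : Fin n) + 1 = 0 := by
    rw [← Nat.cast_add_one, hm, Fin.natCast_self]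
  rw [XX, symmetrize_tensor, zStrings, ← sum_add_one]
  refine congrArg (Complex.I • ·) (Finset.sum_congr rfl fun j _ => ?_)
  have e : (tensor fun k : Fin n => if ((k - (j + 1) : Fin n) : ℕ) + 1 < n then sigmaX else 1) =
      run (site sigmaX) (j + 1) m := by
    rw [run_site _ (by omega)]
    congr 1; ext1 k
    exact if_congr (by omega) rfl rfl
  have hz : site sigmaZ j * run (site sigmaX) (j + 1) m =
      run (site sigmaX) (j + 1) m * site sigmaZ j := by
    rw [run_site _ (by omega), site_mul_tensor, tensor_mul_site]
    congr 1; ext1 k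
    split_ifs with h1 h2
    · subst h1
      have h3 : k - (k + 1) = (m : Fin n) := by
        rw [sub_add_cancel_left, eq_comm, ← add_eq_zero_iff_eq_neg, hcast]
      rw [h3, Fin.val_natCast, Nat.mod_eq_of_lt (by omega)] at h2
      omega
    · simp
    · rfl
    · rfl
  rw [e, str, add_assoc, hcast, add_zero, hz, mul_assoc, isSpinChain_site.z_sq, mul_one]

end Chain

/-! ### The real span of the listed operators -/

/-- A subspace that contains `s` and is stable under bracketing with the elements of `s` contains
the Lie algebra generated by `s`, because its elements normalizing it form a Lie subalgebra. -/
theorem lieSpan_le_of_lie_mem {K L : Type*} [CommRing K] [LieRing L] [LieAlgebra K L] {s : Set L}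
    {V : Submodule K L} (hs : s ⊆ V) (h : ∀ a ∈ s, ∀ v ∈ V, ⁅a, v⁆ ∈ V) :
    (LieSubalgebra.lieSpan K L s).toSubmodule ≤ V := by
  let M : LieSubalgebra K L :=
    { carrier := {a | a ∈ V ∧ ∀ v ∈ V, ⁅a, v⁆ ∈ V}
      add_mem' := fun {a b} ha hb =>
        ⟨V.add_mem ha.1 hb.1, fun v hv => by
          rw [add_lie]; exact V.add_mem (ha.2 v hv) (hb.2 v hv)⟩
      zero_mem' := ⟨V.zero_mem, fun v _ => by rw [zero_lie]; exact V.zero_mem⟩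
      smul_mem' := fun c a ha =>
        ⟨V.smul_mem c ha.1, fun v hv => by rw [smul_lie]; exact V.smul_mem c (ha.2 v hv)⟩
      lie_mem' := fun {a b} ha hb =>
        ⟨ha.2 b hb.1, fun v hv => by
          rw [lie_lie]; exact V.sub_mem (ha.2 _ (hb.2 v hv)) (hb.2 _ (ha.2 v hv))⟩ }
  have hM : LieSubalgebra.lieSpan K L s ≤ M :=
    LieSubalgebra.lieSpan_le.mpr fun a ha => ⟨hs ha, h a ha⟩
  exact fun a ha => (hM ha).1

section Span

open Fin.CommRing

variable {n : ℕ} [NeZero n]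

/-- `i` times the sum of all strings `z ⊗ x^{⊗ m} ⊗ z` in the chain of `n` spins. -/
noncomputable abbrev zz (n : ℕ) [NeZero n] (m : ℕ) : Op n :=
  Complex.I • zStrings (ι := Fin n) (site sigmaX) (site sigmaZ) m

/-- `i` times the sum of all strings `y ⊗ x^{⊗ (m - 1)} ⊗ y` in the chain of `n` spins. -/
noncomputable abbrev yy (n : ℕ) [NeZero n] (m : ℕ) : Op n :=
  Complex.I • yStrings (ι := Fin n) (site sigmaX) (site sigmaZ) m

/-- `i` times the sum of all strings `z ⊗ x^{⊗ (m - 1)} ⊗ y` and `y ⊗ x^{⊗ (m - 1)} ⊗ z` in the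
chain of `n` spins, up to sign. -/
abbrev yz (n : ℕ) [NeZero n] (m : ℕ) : Op n :=
  mixedStrings (ι := Fin n) (site sigmaX) (site sigmaZ) m

section Brackets

theorem I_H0_eq : Complex.I • H0 n = zz n 0 := by
  rw [H0_eq_coupling, zz, zStrings_zero]

theorem I_H1_eq : Complex.I • H1 n = -yy n 0 := by
  rw [yy, isSpinChain_site.yStrings_zero, smul_neg, neg_neg, H1]

theorem I_H1_lie_zz (m : ℕ) : ⁅Complex.I • H1 n, zz n m⁆ = 2 • yz n (m + 1) := by
  rw [zz, lie_smul, smul_lie, H1, isSpinChain_site.field_lie_zStrings, smul_smul, Complex.I_mul_I,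
    neg_one_smul, neg_neg]

theorem I_H1_lie_yy (m : ℕ) : ⁅Complex.I • H1 n, yy n m⁆ = -(2 • yz n m) := by
  rw [yy, lie_smul, smul_lie, H1, isSpinChain_site.field_lie_yStrings, smul_smul, Complex.I_mul_I,
    neg_one_smul]

theorem I_H1_lie_yz (m : ℕ) :
    ⁅Complex.I • H1 n, yz n (m + 1)⁆ = 4 • (yy n (m + 1) - zz n m) := by
  rw [smul_lie, H1, isSpinChain_site.field_lie_mixedStrings, smul_comm, smul_sub]

theorem I_H0_lie_zz [Nontrivial (Fin n)] (m : ℕ) : ⁅Complex.I • H0 n, zz n m⁆ = -(2 • yz n m) := by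
  rw [zz, lie_smul, smul_lie, H0_eq_coupling, isSpinChain_site.coupling_lie_zStrings, smul_smul,
    Complex.I_mul_I, neg_one_smul]

theorem I_H0_lie_yy [Nontrivial (Fin n)] (m : ℕ) :
    ⁅Complex.I • H0 n, yy n m⁆ = 2 • yz n (m + 1) := by
  rw [yy, lie_smul, smul_lie, H0_eq_coupling, isSpinChain_site.coupling_lie_yStrings, smul_smul,
    Complex.I_mul_I, neg_one_smul, neg_neg]

theorem I_H0_lie_yz [Nontrivial (Fin n)] (m : ℕ) :
    ⁅Complex.I • H0 n, yz n (m + 1)⁆ = 4 • (zz n (m + 1) - yy n m) := by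
  rw [smul_lie, H0_eq_coupling, isSpinChain_site.coupling_lie_mixedStrings, smul_comm, smul_sub]

end Brackets

/-- The brackets with the two generators climb one step at a time from `H₀` and `H₁` to all strings,
of any length. -/
theorem strings_mem_dynamicalLieAlgebra [Nontrivial (Fin n)] (m : ℕ) :
    yy n m ∈ dynamicalLieAlgebra n ∧ yz n (m + 1) ∈ dynamicalLieAlgebra n ∧
      zz n m ∈ dynamicalLieAlgebra n := by
  have h0 : Complex.I • H0 n ∈ dynamicalLieAlgebra n := LieSubalgebra.subset_lieSpan (by simp)
  have h1 : Complex.I • H1 n ∈ dynamicalLieAlgebra n := LieSubalgebra.subset_lieSpan (by simp)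
  have half : ∀ {c : ℕ} {a : Op n}, c ≠ 0 → c • a ∈ dynamicalLieAlgebra n →
      a ∈ dynamicalLieAlgebra n := by
    intro c a hc ha
    have := (dynamicalLieAlgebra n).smul_mem (c : ℝ)⁻¹ ha
    rwa [← Nat.cast_smul_eq_nsmul ℝ, inv_smul_smul₀ (Nat.cast_ne_zero.mpr hc)] at this
  have hyz : ∀ k, zz n k ∈ dynamicalLieAlgebra n → yz n (k + 1) ∈ dynamicalLieAlgebra n := by
    intro k hk
    refine half two_ne_zero ?_
    rw [← I_H1_lie_zz]
    exact (dynamicalLieAlgebra n).lie_mem h1 hk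
  induction m with
  | zero =>
    have hz : zz n 0 ∈ dynamicalLieAlgebra n := by rwa [← I_H0_eq]
    refine ⟨?_, hyz 0 hz, hz⟩
    rw [← neg_neg (yy n 0), ← I_H1_eq]
    exact neg_mem h1
  | succ m ih =>
    obtain ⟨hy, hm, hz⟩ := ih
    have hz' : zz n (m + 1) ∈ dynamicalLieAlgebra n := by
      rw [← sub_add_cancel (zz n (m + 1)) (yy n m)]
      refine add_mem (half four_ne_zero ?_) hy
      rw [← I_H0_lie_yz]
      exact (dynamicalLieAlgebra n).lie_mem h0 hm
    refine ⟨?_, hyz _ hz', hz'⟩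
    rw [← sub_add_cancel (yy n (m + 1)) (zz n m)]
    refine add_mem (half four_ne_zero ?_) hz
    rw [← I_H1_lie_yz]
    exact (dynamicalLieAlgebra n).lie_mem h1 hm

theorem element_mem_dynamicalLieAlgebra [Nontrivial (Fin n)] (l : Label n) :
    element n l ∈ dynamicalLieAlgebra n := by
  have hn := NeZero.pos n
  obtain (j | j | j) | (j | j) := l
  · rw [element, Y_eq (by omega)]
    exact (strings_mem_dynamicalLieAlgebra _).1
  · rw [element, Z_eq (by omega)]
    exact (strings_mem_dynamicalLieAlgebra _).2.2
  · rw [element, YZ_eq (by omega)]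
    exact neg_mem (strings_mem_dynamicalLieAlgebra _).2.1
  · rw [element, X_eq]
    exact neg_mem (strings_mem_dynamicalLieAlgebra _).1
  · rw [element, XX_eq (Nat.succ_pred_eq_of_pos hn)]
    exact (strings_mem_dynamicalLieAlgebra _).2.2

theorem zz_mem_span {m : ℕ} (hm : m < n) :
    zz n m ∈ Submodule.span ℝ (Set.range (element n)) := by
  apply Submodule.subset_span
  by_cases h : m + 1 = n
  · exact ⟨.inr (.inr ()), XX_eq h⟩
  · exact ⟨.inl (.inr (.inl ⟨m, by omega⟩)), Z_eq (by omega)⟩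

theorem yy_mem_span {m : ℕ} (hm : m < n) :
    yy n m ∈ Submodule.span ℝ (Set.range (element n)) := by
  obtain _ | m := m
  · rw [← neg_neg (yy n 0), ← X_eq]
    exact neg_mem (Submodule.subset_span ⟨.inr (.inl ()), rfl⟩)
  · exact Submodule.subset_span ⟨.inl (.inl ⟨m, by omega⟩), Y_eq (by omega)⟩

theorem yz_mem_span {m : ℕ} (hm : m ≤ n) :
    yz n m ∈ Submodule.span ℝ (Set.range (element n)) := by
  obtain _ | m := m
  · rw [yz, isSpinChain_site.mixedStrings_zero]
    exact zero_mem _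
  · by_cases h : m + 1 = n
    · rw [yz, isSpinChain_site.mixedStrings_of_cast_eq_zero (by rw [h, Fin.natCast_self])]
      exact zero_mem _
    · rw [← neg_neg (yz n (m + 1)), ← YZ_eq (by omega)]
      exact neg_mem (Submodule.subset_span ⟨.inl (.inr (.inr ⟨m, by omega⟩)), rfl⟩)

/-- Every listed operator is one of the strings, with a length small enough for its brackets with
the generators to be combinations of listed operators again. -/
theorem lie_element_mem_span [Nontrivial (Fin n)] (l : Label n) :
    ⁅Complex.I • H0 n, element n l⁆ ∈ Submodule.span ℝ (Set.range (element n)) ∧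
      ⁅Complex.I • H1 n, element n l⁆ ∈ Submodule.span ℝ (Set.range (element n)) := by
  have hn := NeZero.pos n
  have hz : ∀ {m : ℕ}, m < n →
      ⁅Complex.I • H0 n, zz n m⁆ ∈ Submodule.span ℝ (Set.range (element n)) ∧
        ⁅Complex.I • H1 n, zz n m⁆ ∈ Submodule.span ℝ (Set.range (element n)) := by
    intro m hm
    rw [I_H0_lie_zz, I_H1_lie_zz]
    exact ⟨neg_mem (nsmul_mem (yz_mem_span hm.le) 2), nsmul_mem (yz_mem_span hm) 2⟩
  have hy : ∀ {m : ℕ}, m < n →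
      ⁅Complex.I • H0 n, yy n m⁆ ∈ Submodule.span ℝ (Set.range (element n)) ∧
        ⁅Complex.I • H1 n, yy n m⁆ ∈ Submodule.span ℝ (Set.range (element n)) := by
    intro m hm
    rw [I_H0_lie_yy, I_H1_lie_yy]
    exact ⟨nsmul_mem (yz_mem_span hm) 2, neg_mem (nsmul_mem (yz_mem_span hm.le) 2)⟩
  obtain (j | j | j) | (j | j) := l
  · rw [element, Y_eq (by omega)]
    exact hy (by omega)
  · rw [element, Z_eq (by omega)]
    exact hz (by omega)
  · rw [element, YZ_eq (by omega), lie_neg, lie_neg, I_H0_lie_yz, I_H1_lie_yz]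
    exact ⟨neg_mem (nsmul_mem (sub_mem (zz_mem_span (by omega)) (yy_mem_span (by omega))) 4),
      neg_mem (nsmul_mem (sub_mem (yy_mem_span (by omega)) (zz_mem_span (by omega))) 4)⟩
  · rw [element, X_eq, lie_neg, lie_neg]
    exact ⟨neg_mem (hy hn).1, neg_mem (hy hn).2⟩
  · rw [element, XX_eq (Nat.succ_pred_eq_of_pos hn)]
    exact hz (Nat.pred_lt hn.ne')

theorem span_element_eq [Nontrivial (Fin n)] :
    Submodule.span ℝ (Set.range (element n)) = (dynamicalLieAlgebra n).toSubmodule := by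
  refine le_antisymm ?_ (lieSpan_le_of_lie_mem ?_ ?_)
  · rw [Submodule.span_le]
    rintro _ ⟨l, rfl⟩
    exact element_mem_dynamicalLieAlgebra l
  · rintro a (rfl | rfl)
    · rw [I_H0_eq]
      exact zz_mem_span (NeZero.pos n)
    · rw [I_H1_eq]
      exact neg_mem (yy_mem_span (NeZero.pos n))
  · intro a ha v hv
    induction hv using Submodule.span_induction with
    | mem v hv =>
      obtain ⟨l, rfl⟩ := hv
      obtain rfl | rfl := ha
      · exact (lie_element_mem_span l).1
      · exact (lie_element_mem_span l).2
    | zero => rw [lie_zero]; exact zero_mem _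
    | add v w _ _ hv hw => rw [lie_add]; exact add_mem hv hw
    | smul c v _ hv => rw [lie_smul]; exact Submodule.smul_mem _ c hv

end Span

/-! ### Words in the Pauli matrices -/

section Words

variable {n : ℕ}

/-- The identity and the Pauli matrices `σ_x`, `σ_y`, `σ_z`, numbered from `0` to `3`. -/
def pauli : Fin 4 → Matrix (Fin 2) (Fin 2) ℂ := ![1, sigmaX, sigmaY, sigmaZ]

theorem conjTranspose_pauli (a : Fin 4) : (pauli a).conjTranspose = pauli a := by
  fin_cases a <;> ext i j <;> fin_cases i <;> fin_cases j <;>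
    simp [pauli, sigmaX, sigmaY, sigmaZ, Matrix.conjTranspose_apply]

theorem trace_pauli_mul_pauli (a b : Fin 4) :
    (pauli a * pauli b).trace = if a = b then 2 else 0 := by
  fin_cases a <;> fin_cases b <;>
    simp [pauli, sigmaX, sigmaY, sigmaZ, Matrix.trace_fin_two, one_add_one_eq_two]

/-- The tensor product of Pauli matrices spelled by a word. -/
def wordOp (w : Fin n → Fin 4) : Op n := tensor fun k => pauli (w k)

theorem conjTranspose_wordOp (w : Fin n → Fin 4) : (wordOp w).conjTranspose = wordOp w := by
  simp only [wordOp, conjTranspose_tensor, conjTranspose_pauli]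

theorem trace_wordOp_mul_wordOp (v w : Fin n → Fin 4) :
    (wordOp v * wordOp w).trace = if v = w then 2 ^ n else 0 := by
  simp only [wordOp, tensor_mul, trace_tensor, trace_pauli_mul_pauli, Finset.prod_ite_zero,
    Finset.prod_const, Finset.card_univ, Fintype.card_fin, Finset.mem_univ, true_imp_iff,
    funext_iff]

theorem conjTranspose_permOp (π : Equiv.Perm (Fin n)) :
    (permOp π).conjTranspose = (permOp π).transpose := by
  ext a b
  simp [permOp, Matrix.conjTranspose_apply, apply_ite (star : ℂ → ℂ)]

theorem conjTranspose_I_smul_symmetrize {A : Op n} (hA : A.conjTranspose = A) :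
    (Complex.I • symmetrize A).conjTranspose = -(Complex.I • symmetrize A) := by
  have h : (symmetrize A).conjTranspose = symmetrize A := by
    simp only [symmetrize, Matrix.conjTranspose_sum, Matrix.conjTranspose_mul, hA,
      ← conjTranspose_permOp, Matrix.conjTranspose_conjTranspose, mul_assoc]
  rw [Matrix.conjTranspose_smul, h]
  simp

/-- The word `a x ⋯ x b 1 ⋯ 1` with `j` letters `x`. -/
def linkWord (n j : ℕ) (a b : Fin 4) (k : Fin n) : Fin 4 :=
  if (k : ℕ) = 0 then a else if (k : ℕ) ≤ j then 1 else if (k : ℕ) = j + 1 then b else 0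

theorem link_pauli (j : ℕ) (a b : Fin 4) :
    link n j (pauli a) (pauli b) = wordOp (linkWord n j a b) := by
  rw [link, wordOp]
  congr 1; ext1 k
  simp only [linkWord, apply_ite pauli]
  rfl

/-- A word whose translates, times `i`, sum to the operator with the given label; for `𝐘𝐙^j` it
gives one of the two orbits of strings. -/
def word (n : ℕ) : Label n → Fin n → Fin 4
  | .inl (.inl j) => linkWord n j 2 2
  | .inl (.inr (.inl j)) => linkWord n j 3 3
  | .inl (.inr (.inr j)) => linkWord n j 3 2
  | .inr (.inl _) => fun k => if (k : ℕ) = 0 then 1 else 0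
  | .inr (.inr _) => fun k => if (k : ℕ) + 1 < n then 1 else 0

/-- The second word of a label: that of the other orbit for `𝐘𝐙^j`, and none for the others. -/
def secondWord (n : ℕ) : Label n → Option (Fin n → Fin 4)
  | .inl (.inr (.inr j)) => some (linkWord n j 2 3)
  | _ => none

theorem element_eq (l : Label n) :
    element n l = Complex.I • symmetrize (wordOp (word n l)) +
      (secondWord n l).elim 0 fun w => Complex.I • symmetrize (wordOp w) := by
  obtain (j | j | j) | (j | j) := l
  · simp only [word, secondWord, ← link_pauli, Option.elim, add_zero]; rfl
  · simp only [word, secondWord, ← link_pauli, Option.elim, add_zero]; rfl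
  · simp only [word, secondWord, ← link_pauli, Option.elim]; rfl
  · simp only [word, secondWord, wordOp, apply_ite pauli, Option.elim, add_zero]; rfl
  · simp only [word, secondWord, wordOp, apply_ite pauli, Option.elim, add_zero]; rfl

theorem conjTranspose_element (l : Label n) :
    (element n l).conjTranspose = -element n l := by
  rw [element_eq, Matrix.conjTranspose_add,
    conjTranspose_I_smul_symmetrize (conjTranspose_wordOp _), neg_add]
  congr 1
  cases secondWord n l with
  | none => simp
  | some w => exact conjTranspose_I_smul_symmetrize (conjTranspose_wordOp _)

/-- A weight of the letters, chosen so that the total weight of a word of the list, which is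
invariant under translation, determines its label: a word has fewer than `n` letters `x`, and its
letters `y` and `z`, of which there are two or none, contribute `0`, `2 * n`, `4 * n` or `6 * n`. -/
def letterWeight (n : ℕ) : Fin 4 → ℕ := ![0, 1, n, 3 * n]

/-- The total weight of the letters of a word. -/
def weight (w : Fin n → Fin 4) : ℕ := ∑ k, letterWeight n (w k)

theorem weight_linkWord {j : ℕ} (hj : j + 1 < n) (a b : Fin 4) :
    weight (linkWord n j a b) = letterWeight n a + j + letterWeight n b := by
  have hf : weight (linkWord n j a b) = ∑ k ∈ Finset.range n,
      (if k = 0 then letterWeight n a else if k ≤ j then 1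
        else if k = j + 1 then letterWeight n b else 0) := by
    rw [Finset.sum_range, weight]
    refine Finset.sum_congr rfl fun k _ => ?_
    simp only [linkWord, apply_ite (letterWeight n)]
    rfl
  have h1 : ∀ k ∈ Finset.range j, (if k + 1 = 0 then letterWeight n a else if k + 1 ≤ j then 1
      else if k + 1 = j + 1 then letterWeight n b else 0) = 1 := by
    intro k hk
    rw [Finset.mem_range] at hk
    rw [if_neg (by omega), if_pos (by omega)]
  rw [hf, ← Finset.sum_subset (Finset.range_subset_range.mpr hj), Finset.sum_range_succ,
    Finset.sum_range_succ', Finset.sum_congr rfl h1]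
  · simp; omega
  · intro k _ hk
    rw [Finset.mem_range] at hk
    rw [if_neg (by omega), if_neg (by omega), if_neg (by omega)]

theorem weight_word_single (hn : 0 < n) :
    weight (fun k : Fin n => if (k : ℕ) = 0 then 1 else 0) = 1 := by
  rw [weight, Finset.sum_eq_single ⟨0, hn⟩]
  · simp [letterWeight]
  · intro k _ hk
    rw [if_neg fun h => hk (Fin.ext h)]
    rfl
  · simp

theorem weight_word_all_but_last (hn : 0 < n) :
    weight (fun k : Fin n => if (k : ℕ) + 1 < n then 1 else 0) = n - 1 := by
  obtain ⟨m, rfl⟩ := Nat.exists_eq_succ_of_ne_zero hn.ne'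
  rw [weight, Fin.sum_univ_castSucc]
  simp [letterWeight]

/-- The total weight of the word of a label. -/
def labelWeight (n : ℕ) : Label n → ℕ
  | .inl (.inl j) => j + 2 * n
  | .inl (.inr (.inl j)) => j + 6 * n
  | .inl (.inr (.inr j)) => j + 4 * n
  | .inr (.inl _) => 1
  | .inr (.inr _) => n - 1

theorem weight_word (hn : 0 < n) (l : Label n) : weight (word n l) = labelWeight n l := by
  obtain (j | j | j) | (j | j) := l
  · rw [word, weight_linkWord (by omega)]; simp [letterWeight, labelWeight]; omega
  · rw [word, weight_linkWord (by omega)]; simp [letterWeight, labelWeight]; omega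
  · rw [word, weight_linkWord (by omega)]; simp [letterWeight, labelWeight]; omega
  · exact weight_word_single hn
  · exact weight_word_all_but_last hn

theorem weight_secondWord {l : Label n} {w : Fin n → Fin 4} (h : secondWord n l = some w) :
    weight w = labelWeight n l := by
  obtain (j | j | j) | (j | j) := l <;> simp only [secondWord, reduceCtorEq] at h
  obtain rfl := Option.some.inj h
  rw [weight_linkWord (by omega)]; simp [letterWeight, labelWeight]; omega

/-- For two spins the labels of `𝐗` and `𝐗𝐗` would have the same weight. -/
theorem labelWeight_injective (hn : 3 ≤ n) : Function.Injective (labelWeight n) := by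
  intro l l' h
  obtain (⟨i, hi⟩ | ⟨i, hi⟩ | ⟨i, hi⟩) | (i | i) := l <;>
    obtain (⟨j, hj⟩ | ⟨j, hj⟩ | ⟨j, hj⟩) | (j | j) := l' <;>
    simp only [labelWeight] at h <;> first | omega | rfl | (congr; omega)

section Overlap

variable [NeZero n]

theorem weight_translate (w : Fin n → Fin 4) (j : Fin n) :
    weight (fun k => w (k - j)) = weight w :=
  Equiv.sum_comp (Equiv.subRight j) fun k => letterWeight n (w k)

open Classical in
/-- Distinct words are orthogonal for the trace form, so that pairing with a word counts its
occurrences among the translates. -/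
theorem trace_wordOp_mul_symmetrize (v w : Fin n → Fin 4) :
    (wordOp v * symmetrize (wordOp w)).trace =
      ((Finset.univ.filter fun j : Fin n => v = fun k => w (k - j)).card : ℂ) * 2 ^ n := by
  have h : symmetrize (wordOp w) = ∑ j : Fin n, wordOp fun k => w (k - j) := symmetrize_tensor _
  rw [h, Finset.mul_sum, Matrix.trace_sum]
  simp only [trace_wordOp_mul_wordOp]
  rw [← Finset.sum_filter, Finset.sum_const, nsmul_eq_mul]

theorem exists_trace_wordOp_mul_symmetrize (v w : Fin n → Fin 4) :
    ∃ N : ℕ, (wordOp v * symmetrize (wordOp w)).trace = N * 2 ^ n ∧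
      (v = w → N ≠ 0) ∧ (weight v ≠ weight w → N = 0) := by
  classical
  refine ⟨_, trace_wordOp_mul_symmetrize v w, ?_, ?_⟩
  · rintro rfl
    exact Finset.card_ne_zero_of_mem (a := 0) (by simp)
  · intro h
    rw [Finset.card_eq_zero, Finset.filter_eq_empty_iff]
    intro j _ hj
    exact h (by rw [hj, weight_translate])

theorem trace_wordOp_mul_element (hn : 3 ≤ n) (l l' : Label n) :
    (wordOp (word n l) * element n l').trace = 0 ↔ l ≠ l' := by
  have hw : ∀ {l : Label n}, weight (word n l) = labelWeight n l := weight_word (by omega) _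
  obtain ⟨N, h1, h2, h3⟩ := exists_trace_wordOp_mul_symmetrize (word n l) (word n l')
  obtain ⟨M, h4, h5⟩ : ∃ M : ℕ, (wordOp (word n l) * (secondWord n l').elim 0 fun w =>
      Complex.I • symmetrize (wordOp w)).trace = Complex.I * (M * 2 ^ n) ∧ (l ≠ l' → M = 0) := by
    cases h : secondWord n l' with
    | none => exact ⟨0, by simp, fun _ => rfl⟩
    | some w =>
      obtain ⟨M, h4, -, h5⟩ := exists_trace_wordOp_mul_symmetrize (word n l) w
      refine ⟨M, ?_, fun hl => h5 ?_⟩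
      · rw [Option.elim, mul_smul_comm, Matrix.trace_smul, h4, smul_eq_mul]
      · rw [hw, weight_secondWord h]
        exact (labelWeight_injective hn).ne hl
  rw [element_eq, mul_add, Matrix.trace_add, h4, mul_smul_comm, Matrix.trace_smul, h1, smul_eq_mul,
    ← mul_add, ← add_mul, ← Nat.cast_add]
  have : (Complex.I * (((N + M : ℕ) : ℂ) * 2 ^ n) = 0) ↔ N + M = 0 := by
    simp only [mul_eq_zero, Complex.I_ne_zero, false_or, Nat.cast_eq_zero, pow_eq_zero_iff',
      two_ne_zero, false_and, or_false]
  rw [this]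
  constructor
  · rintro h rfl
    exact h2 rfl (by omega)
  · intro h
    rw [h5 h, h3 (by rw [hw, hw]; exact (labelWeight_injective hn).ne h)]

theorem linearIndependent_element (hn : 3 ≤ n) : LinearIndependent ℝ (element n) := by
  rw [Fintype.linearIndependent_iff]
  intro g hg l
  have h := congrArg (fun A => (wordOp (word n l) * A).trace) hg
  simp only [Finset.mul_sum, Matrix.trace_sum, mul_zero, Matrix.trace_zero, mul_smul_comm,
    Matrix.trace_smul] at h
  rw [Finset.sum_eq_single l] at h
  · refine (smul_eq_zero.mp h).resolve_right fun h' => ?_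
    exact (trace_wordOp_mul_element hn l l).mp h' rfl
  · intro l' _ hl
    rw [(trace_wordOp_mul_element hn l l').mpr hl.symm, smul_zero]
  · simp

end Overlap
end Words

end IsingChain

theorem mainTheorem2 (n : ℕ) (hn : 3 ≤ n) :
    Fintype.card (IsingChain.Label n) = 3 * n - 1 ∧
    (∀ l : IsingChain.Label n,
      (IsingChain.element n l).conjTranspose = -IsingChain.element n l) ∧
    ∃ b : Module.Basis (IsingChain.Label n) ℝ (IsingChain.dynamicalLieAlgebra n),
      ∀ l : IsingChain.Label n, (b l : IsingChain.Op n) = IsingChain.element n l := by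
  have : NeZero n := ⟨by omega⟩
  have : Nontrivial (Fin n) := Fin.nontrivial_iff_two_le.mpr (by omega)
  refine ⟨?_, IsingChain.conjTranspose_element, ?_⟩
  · simp only [Fintype.card_sum, Fintype.card_fin, Fintype.card_unit]
    omega
  · refine ⟨(Module.Basis.span (IsingChain.linearIndependent_element hn)).map
      (LinearEquiv.ofEq _ _ IsingChain.span_element_eq), fun l => ?_⟩
    rw [Module.Basis.map_apply]
    exact congrArg Subtype.val
      (Module.Basis.span_apply (IsingChain.linearIndependent_element hn) l)
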